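/- Let $\lambda$ be a real number with $\lambda\neq 0,1$, and let $f(x,\lambda)=x(x-1)(x-\lambda)$. Define the key polynomials $P_n=P_n(x,\lambda)$, $n\geq 1$, recursively by $$P_1=\frac12\,\frac{\partial f}{\partial x},\qquad P_{n+1}=\frac{\partial P_n}{\partial x}\,f+\Bigl(\frac12-n\Bigr)P_n\,\frac{\partial f}{\partial x}.$$ Then for every $n\in\{2,3,4,5\}$ the polynomial $P_n(x,\lambda)$ in $x$ has exactly one real root $x=\gamma$ with $f(\gamma,\lambda)>0$ if $n-1$ is odd, and exactly two distinct real roots $x=\gamma$ with $f(\gamma,\lambda)>0$ if $n-1$ is even. -/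

import Mathlib

open Polynomial

noncomputable section

/-- The Legendre cubic `f = x (x - 1) (x - lam)` as a polynomial in `x`, for fixed real `lam`. -/
def legendreCubic (lam : ℝ) : ℝ[X] := X * (X - 1) * (X - C lam)

/-- The key polynomials of `f`: `P₁ = f' / 2` and `Pₙ₊₁ = Pₙ' f + (1/2 - n) Pₙ f'` for `n ≥ 1`.
They satisfy `y⁽ⁿ⁾ = f⁻ⁿ y Pₙ` where `y² = f`; the value at `0` follows the same formula. -/
def keyPolynomial (f : ℝ[X]) : ℕ → ℝ[X]
  | 0 => 1
  | 1 => C (1 / 2) * derivative f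
  | n + 2 =>
      derivative (keyPolynomial f (n + 1)) * f
        + C (1 / 2 - ((n + 1 : ℕ) : ℝ)) * keyPolynomial f (n + 1) * derivative f

/-- The real roots `γ` of the `n`-th key polynomial of the Legendre cubic for which `f(γ) > 0`,
as a set (so that each root counts once). -/
def positiveRealRoots (n : ℕ) (lam : ℝ) : Set ℝ :=
  {γ : ℝ | (keyPolynomial (legendreCubic lam) n).IsRoot γ ∧ 0 < (legendreCubic lam).eval γ}

end

/-! The cubic `f` has three real roots `a < b < c`, and it is positive exactly on the oval `(a, b)`
and on the unbounded branch `(c, ∞)`. Put `p = b - a` and `q = c - b`. On the branch write `x = c +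
t`; on the oval use `s = (x - a) / (b - x)`, which maps `(a, b)` onto `(0, ∞)`. Up to a nonzero
factor, `Pₙ` becomes a polynomial in `t` or `s` whose coefficients are explicit in `p, q > 0`.

On the branch these coefficients change sign once, so Descartes' rule
(`existsUnique_pos_root_of_one_sign_change`) gives one root for every `n`. On the oval they all have
the same sign for `n = 2, 4`, hence no root, and change sign once for `n = 3, 5`, hence one root.
The two counts add up to 1 or 2. -/

/-! ### Descartes' rule of signs for one sign change. -/

open Finset in
theorem sum_mul_pow_zero {N : ℕ} (e : Fin (N + 1) → ℝ) :
    ∑ k, e k * (0 : ℝ) ^ (k : ℕ) = e 0 := by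
  rw [Fin.sum_univ_succ]
  simp

/-- A polynomial function with negative leading coefficient takes a negative value at some
positive point. -/
theorem exists_pos_sum_mul_pow_neg {N : ℕ} (e : Fin (N + 1) → ℝ) (h_last : e (Fin.last N) < 0) :
    ∃ s : ℝ, 0 < s ∧ ∑ k, e k * s ^ (k : ℕ) < 0 := by
  -- The reversed polynomial: its value at `0` is the leading coefficient, so by continuity it stays
  -- negative at a small `r > 0`; the point sought is `r⁻¹`.
  have hcont : Continuous fun r : ℝ => ∑ k : Fin (N + 1), e k * r ^ (N - (k : ℕ)) := by fun_prop
  have h0 : ∑ k : Fin (N + 1), e k * (0 : ℝ) ^ (N - (k : ℕ)) < 0 := by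
    rw [Fin.sum_univ_castSucc]
    have : ∀ k : Fin N, e k.castSucc * (0 : ℝ) ^ (N - (k : ℕ)) = 0 := fun k => by
      rw [zero_pow (by have := k.isLt; omega), mul_zero]
    simpa [this] using h_last
  have hev := (hcont.tendsto 0).eventually_lt_const h0
  obtain ⟨r, hr, hrpos⟩ :=
    ((hev.filter_mono nhdsWithin_le_nhds).and
      (self_mem_nhdsWithin : Set.Ioi (0 : ℝ) ∈ nhdsWithin 0 (Set.Ioi 0))).exists
  have hrpos : 0 < r := hrpos
  refine ⟨r⁻¹, inv_pos.2 hrpos, ?_⟩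
  have : ∑ k : Fin (N + 1), e k * r⁻¹ ^ (k : ℕ)
      = r⁻¹ ^ N * ∑ k : Fin (N + 1), e k * r ^ (N - (k : ℕ)) := by
    rw [Finset.mul_sum]
    refine Finset.sum_congr rfl fun k _ => ?_
    have hk : (k : ℕ) + (N - k) = N := by have := k.isLt; omega
    have h1 : r⁻¹ ^ (N - (k : ℕ)) * r ^ (N - (k : ℕ)) = 1 := by
      rw [← mul_pow, inv_mul_cancel₀ hrpos.ne', one_pow]
    calc e k * r⁻¹ ^ (k : ℕ)
        = e k * r⁻¹ ^ (k : ℕ) * (r⁻¹ ^ (N - (k : ℕ)) * r ^ (N - (k : ℕ))) := by rw [h1, mul_one]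
      _ = r⁻¹ ^ ((k : ℕ) + (N - k)) * (e k * r ^ (N - (k : ℕ))) := by rw [pow_add]; ring
      _ = _ := by rw [hk]
  rw [this]
  exact mul_neg_of_pos_of_neg (by positivity) hr

/-- The uniqueness half of Descartes' rule of signs for one sign change. -/
theorem not_both_roots_of_one_sign_change {N : ℕ} (e : Fin (N + 1) → ℝ) (m : ℕ) (hm : 0 < m)
    (h_zero : 0 < e 0) (h_lt : ∀ k : Fin (N + 1), (k : ℕ) < m → 0 ≤ e k)
    (h_gt : ∀ k : Fin (N + 1), m < (k : ℕ) → e k ≤ 0) {s t : ℝ} (hs : 0 < s) (hst : s < t)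
    (hs0 : ∑ k, e k * s ^ (k : ℕ) = 0) (ht0 : ∑ k, e k * t ^ (k : ℕ) = 0) : False := by
  have ht : 0 < t := hs.trans hst
  -- For `s < t` the bracket has the sign of `m - k`, so every term is nonnegative and the term `k =
  -- 0` is positive. The term `k = m` vanishes, so the sign of `e m` plays no role.
  have hsum : ∑ k : Fin (N + 1), e k * (s ^ (k : ℕ) * t ^ m - t ^ (k : ℕ) * s ^ m) = 0 := by
    have : ∑ k : Fin (N + 1), e k * (s ^ (k : ℕ) * t ^ m - t ^ (k : ℕ) * s ^ m)
        = t ^ m * ∑ k, e k * s ^ (k : ℕ) - s ^ m * ∑ k, e k * t ^ (k : ℕ) := by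
      rw [Finset.mul_sum, Finset.mul_sum, ← Finset.sum_sub_distrib]
      exact Finset.sum_congr rfl fun k _ => by ring
    rw [this, hs0, ht0, mul_zero, mul_zero, sub_zero]
  have hpos : 0 < ∑ k : Fin (N + 1), e k * (s ^ (k : ℕ) * t ^ m - t ^ (k : ℕ) * s ^ m) := by
    refine Finset.sum_pos' (fun k _ => ?_) ⟨0, Finset.mem_univ _, ?_⟩
    · rcases lt_trichotomy (k : ℕ) m with hk | hk | hk
      · refine mul_nonneg (h_lt k hk) (sub_nonneg.2 ?_)
        obtain ⟨j, rfl⟩ := Nat.exists_eq_add_of_lt hk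
        have := pow_le_pow_left₀ hs.le hst.le (j + 1)
        calc t ^ (k : ℕ) * s ^ ((k : ℕ) + j + 1)
            = (s * t) ^ (k : ℕ) * s ^ (j + 1) := by ring
          _ ≤ (s * t) ^ (k : ℕ) * t ^ (j + 1) := by gcongr
          _ = _ := by ring
      · rw [hk]
        exact le_of_eq (by ring)
      · refine mul_nonneg_of_nonpos_of_nonpos (h_gt k hk) (sub_nonpos.2 ?_)
        obtain ⟨j, hj⟩ := Nat.exists_eq_add_of_lt hk
        rw [hj]
        calc s ^ (m + j + 1) * t ^ m = (s * t) ^ m * s ^ (j + 1) := by ring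
          _ ≤ (s * t) ^ m * t ^ (j + 1) := by gcongr
          _ = _ := by ring
    · have := pow_lt_pow_left₀ hst hs.le hm.ne'
      simpa using mul_pos h_zero (sub_pos.2 this)
  exact hpos.ne' hsum

/-- Descartes' rule of signs for a coefficient vector with exactly one sign change. -/
theorem existsUnique_pos_root_of_one_sign_change {N : ℕ} (e : Fin (N + 1) → ℝ) (m : ℕ)
    (hm : 0 < m) (h_zero : 0 < e 0) (h_last : e (Fin.last N) < 0)
    (h_lt : ∀ k : Fin (N + 1), (k : ℕ) < m → 0 ≤ e k)
    (h_gt : ∀ k : Fin (N + 1), m < (k : ℕ) → e k ≤ 0) :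
    ∃! s : ℝ, 0 < s ∧ ∑ k, e k * s ^ (k : ℕ) = 0 := by
  obtain ⟨r, hr, hneg⟩ := exists_pos_sum_mul_pow_neg e h_last
  have hcont : Continuous fun s : ℝ => ∑ k : Fin (N + 1), e k * s ^ (k : ℕ) := by fun_prop
  obtain ⟨s, hs, hs0⟩ := intermediate_value_Icc' hr.le hcont.continuousOn
    (show (0 : ℝ) ∈ Set.Icc _ _ from ⟨hneg.le, by simpa only [sum_mul_pow_zero] using h_zero.le⟩)
  have hspos : 0 < s := by
    refine lt_of_le_of_ne hs.1 ?_
    rintro rfl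
    exact h_zero.ne' ((sum_mul_pow_zero e).symm.trans hs0)
  refine ⟨s, ⟨hspos, hs0⟩, fun t ⟨ht, ht0⟩ => ?_⟩
  rcases lt_trichotomy t s with h | h | h
  · exact (not_both_roots_of_one_sign_change e m hm h_zero h_lt h_gt ht h ht0 hs0).elim
  · exact h
  · exact (not_both_roots_of_one_sign_change e m hm h_zero h_lt h_gt hspos h hs0 ht0).elim

/-! ### Key polynomials as forms in `f`, `f'`, `f''`. -/

/-- The monic cubic with roots `a`, `b`, `c`. -/
noncomputable def monicCubic (a b c : ℝ) : ℝ[X] := (X - C a) * (X - C b) * (X - C c)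

theorem eval_monicCubic (a b c x : ℝ) :
    (monicCubic a b c).eval x = (x - a) * (x - b) * (x - c) := by
  simp [monicCubic]

theorem eval_derivative_monicCubic (a b c x : ℝ) : (derivative (monicCubic a b c)).eval x
    = (x - a) * (x - b) + (x - a) * (x - c) + (x - b) * (x - c) := by
  simp [monicCubic]
  ring

theorem derivative_derivative_monicCubic (a b c : ℝ) :
    derivative (derivative (monicCubic a b c)) = C 6 * X - C (2 * (a + b + c)) := by
  simp only [monicCubic, derivative_mul, derivative_sub, derivative_X, derivative_C,
    derivative_zero, derivative_one, map_mul, map_add, map_ofNat]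
  ring

/-- The `n`-th key polynomial of a monic cubic, for `2 ≤ n ≤ 5`, as a function of the values
`y₀`, `y₁`, `y₂` of the cubic and of its first two derivatives. -/
noncomputable def keyForm (y₀ y₁ y₂ : ℝ) : ℕ → ℝ
  | 2 => y₀ * y₂ / 2 - y₁ ^ 2 / 4
  | 3 => 3 * y₀ ^ 2 - 3 / 4 * y₀ * y₁ * y₂ + 3 / 8 * y₁ ^ 3
  | 4 => -6 * y₀ ^ 2 * y₁ - 3 / 4 * y₀ ^ 2 * y₂ ^ 2 + 9 / 4 * y₀ * y₁ ^ 2 * y₂ - 15 / 16 * y₁ ^ 4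
  | 5 => -15 * y₀ ^ 3 * y₂ + 45 / 2 * y₀ ^ 2 * y₁ ^ 2 + 45 / 8 * y₀ ^ 2 * y₁ * y₂ ^ 2
      - 75 / 8 * y₀ * y₁ ^ 3 * y₂ + 105 / 32 * y₁ ^ 5
  | _ => 0

/-- The key form is weighted homogeneous. -/
theorem keyForm_mul (y₀ y₁ y₂ r : ℝ) (n : ℕ) :
    keyForm (y₀ * r ^ 3) (y₁ * r ^ 2) (y₂ * r) n = keyForm y₀ y₁ y₂ n * r ^ (2 * n) := by
  unfold keyForm
  split <;> ring

/-- Since `f''' = 6` is constant, the recursion never leaves the polynomials in `f`, `f'`, `f''`. -/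
theorem eval_keyPolynomial_monicCubic (a b c x : ℝ) {n : ℕ} (hn₂ : 2 ≤ n) (hn₅ : n ≤ 5) :
    (keyPolynomial (monicCubic a b c) n).eval x
      = keyForm ((x - a) * (x - b) * (x - c))
          ((x - a) * (x - b) + (x - a) * (x - c) + (x - b) * (x - c))
          (6 * x - 2 * (a + b + c)) n := by
  rw [← eval_monicCubic, ← eval_derivative_monicCubic]
  have h := derivative_derivative_monicCubic a b c
  -- From here on only the formula for `f''` is used.
  generalize monicCubic a b c = f at h ⊢
  interval_cases n <;>
  · simp only [keyPolynomial, keyForm, derivative_mul, derivative_add, derivative_sub, derivative_C,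
      derivative_X, derivative_zero, h, eval_add, eval_sub, eval_mul, eval_C, eval_X, eval_zero,
      zero_mul, zero_add, mul_one, sub_zero]
    push_cast
    ring

/-! ### Sign patterns on the unbounded branch. -/

/-- The arguments of `keyForm` are `f`, `f'`, `f''` at `x = c + t`. For each `n` the coefficient of
`t ^ (2n - 3)` vanishes and separates the two signs. -/
theorem existsUnique_keyForm_right_2 {p q : ℝ} (hp : 0 < p) (hq : 0 < q) :
    ∃! t : ℝ, 0 < t ∧
      keyForm (t * (t + q) * (t + p + q))
        (t * (t + q) + t * (t + p + q) + (t + q) * (t + p + q)) (6 * t + 2 * p + 4 * q) 2 = 0 := by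
  let e : Fin 5 → ℝ :=
    ![q ^ 2 * (p ^ 2 + 2 * p * q + q ^ 2),
      0,
      -(6 * q * (p + q)),
      -(4 * (p + 2 * q)),
      -(3)]
  -- The factor `(-1) ^ (n - 1) / 2 ^ n`, here with `n = 2`, clears denominators and makes `e 0`
  -- positive.
  have h : ∀ t : ℝ, keyForm (t * (t + q) * (t + p + q))
        (t * (t + q) + t * (t + p + q) + (t + q) * (t + p + q)) (6 * t + 2 * p + 4 * q) 2
      = -(1 / 4) * ∑ k, e k * t ^ (k : ℕ) := fun t => by
    simp only [keyForm, e, Fin.sum_univ_succ, Fin.sum_univ_zero, Matrix.cons_val_zero,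
      Matrix.cons_val_succ, Fin.val_succ, Fin.val_zero]
    ring
  have hr : (-(1 / 4) : ℝ) ≠ 0 := by norm_num
  simp only [h, mul_eq_zero, hr, false_or]
  refine existsUnique_pos_root_of_one_sign_change e 1 (by norm_num) ?_ ?_ ?_ ?_
  · simp only [e, Matrix.cons_val_zero]; positivity
  · exact neg_lt_zero.2 (by positivity)
  · rw [Fin.forall_iff]
    intro k _ (hk : k < 1)
    interval_cases k
    dsimp [e]
    positivity
  · rw [Fin.forall_iff]
    intro k hk' (hk : 1 < k)
    interval_cases k <;> exact neg_nonpos.2 (by positivity)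

theorem existsUnique_keyForm_right_3 {p q : ℝ} (hp : 0 < p) (hq : 0 < q) :
    ∃! t : ℝ, 0 < t ∧
      keyForm (t * (t + q) * (t + p + q))
        (t * (t + q) + t * (t + p + q) + (t + q) * (t + p + q)) (6 * t + 2 * p + 4 * q) 3 = 0 := by
  let e : Fin 7 → ℝ :=
    ![3 * q ^ 3 * (p ^ 3 + 3 * p ^ 2 * q + 3 * p * q ^ 2 + q ^ 3),
      6 * q ^ 2 * (p ^ 3 + 4 * p ^ 2 * q + 5 * p * q ^ 2 + 2 * q ^ 3),
      15 * q ^ 2 * (p ^ 2 + 2 * p * q + q ^ 2),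
      0,
      -(15 * q * (p + q)),
      -(6 * (p + 2 * q)),
      -(3)]
  have h : ∀ t : ℝ, keyForm (t * (t + q) * (t + p + q))
        (t * (t + q) + t * (t + p + q) + (t + q) * (t + p + q)) (6 * t + 2 * p + 4 * q) 3
      = (1 / 8) * ∑ k, e k * t ^ (k : ℕ) := fun t => by
    simp only [keyForm, e, Fin.sum_univ_succ, Fin.sum_univ_zero, Matrix.cons_val_zero,
      Matrix.cons_val_succ, Fin.val_succ, Fin.val_zero]
    ring
  have hr : ((1 / 8) : ℝ) ≠ 0 := by norm_num
  simp only [h, mul_eq_zero, hr, false_or]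
  refine existsUnique_pos_root_of_one_sign_change e 3 (by norm_num) ?_ ?_ ?_ ?_
  · simp only [e, Matrix.cons_val_zero]; positivity
  · exact neg_lt_zero.2 (by positivity)
  · rw [Fin.forall_iff]
    intro k _ (hk : k < 3)
    interval_cases k <;> (dsimp [e]; positivity)
  · rw [Fin.forall_iff]
    intro k hk' (hk : 3 < k)
    interval_cases k <;> exact neg_nonpos.2 (by positivity)

theorem existsUnique_keyForm_right_4 {p q : ℝ} (hp : 0 < p) (hq : 0 < q) :
    ∃! t : ℝ, 0 < t ∧
      keyForm (t * (t + q) * (t + p + q))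
        (t * (t + q) + t * (t + p + q) + (t + q) * (t + p + q)) (6 * t + 2 * p + 4 * q) 4 = 0 := by
  let e : Fin 9 → ℝ :=
    ![15 * q ^ 4 * (p ^ 4 + 4 * p ^ 3 * q + 6 * p ^ 2 * q ^ 2 + 4 * p * q ^ 3 + q ^ 4),
      48 * q ^ 3 * (p ^ 4 + 5 * p ^ 3 * q + 9 * p ^ 2 * q ^ 2 + 7 * p * q ^ 3 + 2 * q ^ 4),
      12 * q ^ 2 * (4 * p ^ 4 + 29 * p ^ 3 * q + 67 * p ^ 2 * q ^ 2 + 63 * p * q ^ 3 + 21 * q ^ 4),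
      168 * q ^ 2 * (p ^ 3 + 4 * p ^ 2 * q + 5 * p * q ^ 2 + 2 * q ^ 3),
      210 * q ^ 2 * (p ^ 2 + 2 * p * q + q ^ 2),
      0,
      -(84 * q * (p + q)),
      -(24 * (p + 2 * q)),
      -(9)]
  have h : ∀ t : ℝ, keyForm (t * (t + q) * (t + p + q))
        (t * (t + q) + t * (t + p + q) + (t + q) * (t + p + q)) (6 * t + 2 * p + 4 * q) 4
      = -(1 / 16) * ∑ k, e k * t ^ (k : ℕ) := fun t => by
    simp only [keyForm, e, Fin.sum_univ_succ, Fin.sum_univ_zero, Matrix.cons_val_zero,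
      Matrix.cons_val_succ, Fin.val_succ, Fin.val_zero]
    ring
  have hr : (-(1 / 16) : ℝ) ≠ 0 := by norm_num
  simp only [h, mul_eq_zero, hr, false_or]
  refine existsUnique_pos_root_of_one_sign_change e 5 (by norm_num) ?_ ?_ ?_ ?_
  · simp only [e, Matrix.cons_val_zero]; positivity
  · exact neg_lt_zero.2 (by positivity)
  · rw [Fin.forall_iff]
    intro k _ (hk : k < 5)
    interval_cases k <;> (dsimp [e]; positivity)
  · rw [Fin.forall_iff]
    intro k hk' (hk : 5 < k)
    interval_cases k <;> exact neg_nonpos.2 (by positivity)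

theorem existsUnique_keyForm_right_5 {p q : ℝ} (hp : 0 < p) (hq : 0 < q) :
    ∃! t : ℝ, 0 < t ∧
      keyForm (t * (t + q) * (t + p + q))
        (t * (t + q) + t * (t + p + q) + (t + q) * (t + p + q)) (6 * t + 2 * p + 4 * q) 5 = 0 := by
  let e : Fin 11 → ℝ :=
    ![105 * q ^ 5 * (p ^ 5 + 5 * p ^ 4 * q + 10 * p ^ 3 * q ^ 2 + 10 * p ^ 2 * q ^ 3 + 5 * p * q ^ 4 + q ^ 5),
      450 * q ^ 4 * (p ^ 5 + 6 * p ^ 4 * q + 14 * p ^ 3 * q ^ 2 + 16 * p ^ 2 * q ^ 3 + 9 * p * q ^ 4 + 2 * q ^ 5),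
      45 * q ^ 3 * (16 * p ^ 5 + 123 * p ^ 4 * q + 348 * p ^ 3 * q ^ 2 + 466 * p ^ 2 * q ^ 3 + 300 * p * q ^ 4 + 75 * q ^ 5),
      240 * q ^ 2 * (2 * p ^ 5 + 23 * p ^ 4 * q + 85 * p ^ 3 * q ^ 2 + 139 * p ^ 2 * q ^ 3 + 105 * p * q ^ 4 + 30 * q ^ 5),
      270 * q ^ 2 * (8 * p ^ 4 + 51 * p ^ 3 * q + 113 * p ^ 2 * q ^ 2 + 105 * p * q ^ 3 + 35 * q ^ 4),
      3780 * q ^ 2 * (p ^ 3 + 4 * p ^ 2 * q + 5 * p * q ^ 2 + 2 * q ^ 3),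
      3150 * q ^ 2 * (p ^ 2 + 2 * p * q + q ^ 2),
      0,
      -(675 * q * (p + q)),
      -(150 * (p + 2 * q)),
      -(45)]
  have h : ∀ t : ℝ, keyForm (t * (t + q) * (t + p + q))
        (t * (t + q) + t * (t + p + q) + (t + q) * (t + p + q)) (6 * t + 2 * p + 4 * q) 5
      = (1 / 32) * ∑ k, e k * t ^ (k : ℕ) := fun t => by
    simp only [keyForm, e, Fin.sum_univ_succ, Fin.sum_univ_zero, Matrix.cons_val_zero,
      Matrix.cons_val_succ, Fin.val_succ, Fin.val_zero]
    ring
  have hr : ((1 / 32) : ℝ) ≠ 0 := by norm_num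
  simp only [h, mul_eq_zero, hr, false_or]
  refine existsUnique_pos_root_of_one_sign_change e 7 (by norm_num) ?_ ?_ ?_ ?_
  · simp only [e, Matrix.cons_val_zero]; positivity
  · exact neg_lt_zero.2 (by positivity)
  · rw [Fin.forall_iff]
    intro k _ (hk : k < 7)
    interval_cases k <;> (dsimp [e]; positivity)
  · rw [Fin.forall_iff]
    intro k hk' (hk : 7 < k)
    interval_cases k <;> exact neg_nonpos.2 (by positivity)

/-! ### Sign patterns on the oval. -/

theorem keyForm_oval_2_neg {p q s : ℝ} (hp : 0 < p) (hq : 0 < q) (hs : 0 < s) :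
    keyForm (p ^ 2 * s * (p + q * (1 + s)))
        (-(p ^ 2 * s) - p * s * (p + q * (1 + s)) + p * (p + q * (1 + s)))
        (2 * p * s - 2 * p - 2 * (p + q * (1 + s))) 2 < 0 := by
  have h : keyForm (p ^ 2 * s * (p + q * (1 + s)))
        (-(p ^ 2 * s) - p * s * (p + q * (1 + s)) + p * (p + q * (1 + s)))
        (2 * p * s - 2 * p - 2 * (p + q * (1 + s))) 2
      = -(1 / 4) * (p ^ 2 * (p ^ 2 + 2 * p * q + q ^ 2) * s ^ 0 + 4 * p ^ 2 * (p ^ 2 + 2 * p * q + q ^ 2) * s ^ 1 + 6 * p ^ 2 * q * (p + q) * s ^ 2 + 4 * p ^ 2 * q ^ 2 * s ^ 3 + p ^ 2 * q ^ 2 * s ^ 4) := by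
    simp only [keyForm]
    ring
  rw [h]
  exact mul_neg_of_neg_of_pos (by norm_num) (by positivity)

theorem existsUnique_keyForm_oval_3 {p q : ℝ} (hp : 0 < p) (hq : 0 < q) :
    ∃! s : ℝ, 0 < s ∧
      keyForm (p ^ 2 * s * (p + q * (1 + s)))
        (-(p ^ 2 * s) - p * s * (p + q * (1 + s)) + p * (p + q * (1 + s)))
        (2 * p * s - 2 * p - 2 * (p + q * (1 + s))) 3 = 0 := by
  let e : Fin 7 → ℝ :=
    ![3 * p ^ 3 * (p ^ 3 + 3 * p ^ 2 * q + 3 * p * q ^ 2 + q ^ 3),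
      6 * p ^ 3 * (p ^ 3 + 4 * p ^ 2 * q + 5 * p * q ^ 2 + 2 * q ^ 3),
      15 * p ^ 3 * q * (p ^ 2 + 2 * p * q + q ^ 2),
      0,
      -(15 * p ^ 3 * q ^ 2 * (p + q)),
      -(6 * p ^ 3 * q ^ 2 * (p + 2 * q)),
      -(3 * p ^ 3 * q ^ 3)]
  have h : ∀ s : ℝ, keyForm (p ^ 2 * s * (p + q * (1 + s)))
        (-(p ^ 2 * s) - p * s * (p + q * (1 + s)) + p * (p + q * (1 + s)))
        (2 * p * s - 2 * p - 2 * (p + q * (1 + s))) 3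
      = (1 / 8) * ∑ k, e k * s ^ (k : ℕ) := fun s => by
    simp only [keyForm, e, Fin.sum_univ_succ, Fin.sum_univ_zero, Matrix.cons_val_zero,
      Matrix.cons_val_succ, Fin.val_succ, Fin.val_zero]
    ring
  have hr : ((1 / 8) : ℝ) ≠ 0 := by norm_num
  simp only [h, mul_eq_zero, hr, false_or]
  refine existsUnique_pos_root_of_one_sign_change e 3 (by norm_num) ?_ ?_ ?_ ?_
  · simp only [e, Matrix.cons_val_zero]; positivity
  · exact neg_lt_zero.2 (by positivity)
  · rw [Fin.forall_iff]
    intro k _ (hk : k < 3)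
    interval_cases k <;> (dsimp [e]; positivity)
  · rw [Fin.forall_iff]
    intro k hk' (hk : 3 < k)
    interval_cases k <;> exact neg_nonpos.2 (by positivity)

theorem keyForm_oval_4_neg {p q s : ℝ} (hp : 0 < p) (hq : 0 < q) (hs : 0 < s) :
    keyForm (p ^ 2 * s * (p + q * (1 + s)))
        (-(p ^ 2 * s) - p * s * (p + q * (1 + s)) + p * (p + q * (1 + s)))
        (2 * p * s - 2 * p - 2 * (p + q * (1 + s))) 4 < 0 := by
  have h : keyForm (p ^ 2 * s * (p + q * (1 + s)))
        (-(p ^ 2 * s) - p * s * (p + q * (1 + s)) + p * (p + q * (1 + s)))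
        (2 * p * s - 2 * p - 2 * (p + q * (1 + s))) 4
      = -(1 / 16) * (15 * p ^ 4 * (p ^ 4 + 4 * p ^ 3 * q + 6 * p ^ 2 * q ^ 2 + 4 * p * q ^ 3 + q ^ 4) * s ^ 0 + 24 * p ^ 4 * (p ^ 4 + 6 * p ^ 3 * q + 12 * p ^ 2 * q ^ 2 + 10 * p * q ^ 3 + 3 * q ^ 4) * s ^ 1 + 12 * p ^ 4 * q * (7 * p ^ 3 + 25 * p ^ 2 * q + 29 * p * q ^ 2 + 11 * q ^ 3) * s ^ 2 + 120 * p ^ 4 * q ^ 2 * (p ^ 2 + 2 * p * q + q ^ 2) * s ^ 3 + 90 * p ^ 4 * q ^ 2 * (p ^ 2 + 2 * p * q + q ^ 2) * s ^ 4 + 120 * p ^ 4 * q ^ 2 * (p ^ 2 + 2 * p * q + q ^ 2) * s ^ 5 + 12 * p ^ 4 * q ^ 2 * (4 * p ^ 2 + 15 * p * q + 11 * q ^ 2) * s ^ 6 + 24 * p ^ 4 * q ^ 3 * (2 * p + 3 * q) * s ^ 7 + 15 * p ^ 4 * q ^ 4 * s ^ 8) := by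
    simp only [keyForm]
    ring
  rw [h]
  exact mul_neg_of_neg_of_pos (by norm_num) (by positivity)

theorem existsUnique_keyForm_oval_5 {p q : ℝ} (hp : 0 < p) (hq : 0 < q) :
    ∃! s : ℝ, 0 < s ∧
      keyForm (p ^ 2 * s * (p + q * (1 + s)))
        (-(p ^ 2 * s) - p * s * (p + q * (1 + s)) + p * (p + q * (1 + s)))
        (2 * p * s - 2 * p - 2 * (p + q * (1 + s))) 5 = 0 := by
  let e : Fin 11 → ℝ :=
    ![105 * p ^ 5 * (p ^ 5 + 5 * p ^ 4 * q + 10 * p ^ 3 * q ^ 2 + 10 * p ^ 2 * q ^ 3 + 5 * p * q ^ 4 + q ^ 5),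
      150 * p ^ 5 * (p ^ 5 + 8 * p ^ 4 * q + 22 * p ^ 3 * q ^ 2 + 28 * p ^ 2 * q ^ 3 + 17 * p * q ^ 4 + 4 * q ^ 5),
      45 * p ^ 5 * q * (15 * p ^ 4 + 76 * p ^ 3 * q + 138 * p ^ 2 * q ^ 2 + 108 * p * q ^ 3 + 31 * q ^ 4),
      240 * p ^ 5 * q ^ 2 * (5 * p ^ 3 + 17 * p ^ 2 * q + 19 * p * q ^ 2 + 7 * q ^ 3),
      150 * p ^ 5 * q ^ 2 * (- p ^ 3 + 5 * p ^ 2 * q + 13 * p * q ^ 2 + 7 * q ^ 3),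
      -(900 * p ^ 6 * q ^ 2 * (p ^ 2 + 2 * p * q + q ^ 2)),
      -(150 * p ^ 5 * q ^ 2 * (8 * p ^ 3 + 23 * p ^ 2 * q + 22 * p * q ^ 2 + 7 * q ^ 3)),
      -(240 * p ^ 5 * q ^ 2 * (2 * p ^ 3 + 11 * p ^ 2 * q + 16 * p * q ^ 2 + 7 * q ^ 3)),
      -(45 * p ^ 5 * q ^ 3 * (16 * p ^ 2 + 47 * p * q + 31 * q ^ 2)),
      -(150 * p ^ 5 * q ^ 4 * (3 * p + 4 * q)),
      -(105 * p ^ 5 * q ^ 5)]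
  have h : ∀ s : ℝ, keyForm (p ^ 2 * s * (p + q * (1 + s)))
        (-(p ^ 2 * s) - p * s * (p + q * (1 + s)) + p * (p + q * (1 + s)))
        (2 * p * s - 2 * p - 2 * (p + q * (1 + s))) 5
      = (1 / 32) * ∑ k, e k * s ^ (k : ℕ) := fun s => by
    simp only [keyForm, e, Fin.sum_univ_succ, Fin.sum_univ_zero, Matrix.cons_val_zero,
      Matrix.cons_val_succ, Fin.val_succ, Fin.val_zero]
    ring
  have hr : ((1 / 32) : ℝ) ≠ 0 := by norm_num
  simp only [h, mul_eq_zero, hr, false_or]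
  -- The sign of `e 4` depends on `p` and `q`. As `e 3 > 0 > e 5`, there is one sign change either
  -- way, and `m = 4` leaves `e 4` unconstrained.
  refine existsUnique_pos_root_of_one_sign_change e 4 (by norm_num) ?_ ?_ ?_ ?_
  · simp only [e, Matrix.cons_val_zero]; positivity
  · exact neg_lt_zero.2 (by positivity)
  · rw [Fin.forall_iff]
    intro k _ (hk : k < 4)
    interval_cases k <;> (dsimp [e]; positivity)
  · rw [Fin.forall_iff]
    intro k hk' (hk : 4 < k)
    interval_cases k <;> exact neg_nonpos.2 (by positivity)

/-! ### Back to roots in `x`. -/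

theorem existsUnique_root_right {a b c : ℝ} (hab : a < b) (hbc : b < c) {n : ℕ} (hn₂ : 2 ≤ n)
    (hn₅ : n ≤ 5) : ∃! x, c < x ∧ (keyPolynomial (monicCubic a b c) n).IsRoot x := by
  have key : ∃! t : ℝ, 0 < t ∧ keyForm (t * (t + (c - b)) * (t + (b - a) + (c - b)))
      (t * (t + (c - b)) + t * (t + (b - a) + (c - b)) + (t + (c - b)) * (t + (b - a) + (c - b)))
      (6 * t + 2 * (b - a) + 4 * (c - b)) n = 0 := by
    have hp := sub_pos.2 hab
    have hq := sub_pos.2 hbc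
    interval_cases n
    · exact existsUnique_keyForm_right_2 hp hq
    · exact existsUnique_keyForm_right_3 hp hq
    · exact existsUnique_keyForm_right_4 hp hq
    · exact existsUnique_keyForm_right_5 hp hq
  have heq : ∀ x : ℝ, (keyPolynomial (monicCubic a b c) n).IsRoot x ↔
      keyForm ((x - c) * (x - c + (c - b)) * (x - c + (b - a) + (c - b)))
        ((x - c) * (x - c + (c - b)) + (x - c) * (x - c + (b - a) + (c - b))
          + (x - c + (c - b)) * (x - c + (b - a) + (c - b)))
        (6 * (x - c) + 2 * (b - a) + 4 * (c - b)) n = 0 := fun x => by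
    rw [IsRoot.def, eval_keyPolynomial_monicCubic a b c x hn₂ hn₅]
    ring_nf
  obtain ⟨t, ⟨ht, ht0⟩, huniq⟩ := key
  refine ⟨c + t, ⟨by linarith, (heq _).2 ?_⟩, fun x ⟨hx, hx0⟩ => ?_⟩
  · rwa [add_sub_cancel_left]
  · have := huniq (x - c) ⟨sub_pos.2 hx, (heq x).1 hx0⟩
    linarith

/-- On the oval, parametrized by `s = (x - a) / (b - x)`, the key polynomial is a positive multiple
of a key form that is polynomial in `s`. -/
theorem isRoot_keyPolynomial_oval_iff {a b c x : ℝ} (hax : a < x) (hxb : x < b) {n : ℕ}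
    (hn₂ : 2 ≤ n) (hn₅ : n ≤ 5) {p q s : ℝ} (hp : p = b - a) (hq : q = c - b)
    (hs : s = (x - a) / (b - x)) :
    (keyPolynomial (monicCubic a b c) n).IsRoot x ↔
      keyForm (p ^ 2 * s * (p + q * (1 + s)))
        (-(p ^ 2 * s) - p * s * (p + q * (1 + s)) + p * (p + q * (1 + s)))
        (2 * p * s - 2 * p - 2 * (p + q * (1 + s))) n = 0 := by
  have hbx : 0 < b - x := sub_pos.2 hxb
  have hba : 0 < b - a := by linarith
  have hr : 0 < (b - x) / (b - a) := div_pos hbx hba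
  -- Here `(b - x) / (b - a) = 1 / (1 + s)`: `f`, `f'`, `f''` at `x` are the polynomial arguments
  -- times its third, second and first powers, so homogeneity clears the denominators.
  rw [← mul_eq_zero_iff_right (pow_ne_zero (2 * n) hr.ne'), ← keyForm_mul, IsRoot.def,
    eval_keyPolynomial_monicCubic a b c x hn₂ hn₅]
  subst hp hq hs
  have h1 : 1 + (x - a) / (b - x) = (b - a) / (b - x) := by field_simp; ring
  rw [h1]
  congr! 2
  · field_simp
    ring
  · field_simp
    ring
  · field_simp
    ring

theorem not_isRoot_oval_of_even {a b c : ℝ} (hbc : b < c) {n : ℕ} (hn₂ : 2 ≤ n)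
    (hn₅ : n ≤ 5) (hn : Even n) {x : ℝ} (hax : a < x) (hxb : x < b) :
    ¬ (keyPolynomial (monicCubic a b c) n).IsRoot x := by
  rw [isRoot_keyPolynomial_oval_iff hax hxb hn₂ hn₅ rfl rfl rfl]
  have hp := sub_pos.2 (hax.trans hxb)
  have hq := sub_pos.2 hbc
  have hs := div_pos (sub_pos.2 hax) (sub_pos.2 hxb)
  interval_cases n
  · exact (keyForm_oval_2_neg hp hq hs).ne
  · exact absurd hn (by decide)
  · exact (keyForm_oval_4_neg hp hq hs).ne
  · exact absurd hn (by decide)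

theorem existsUnique_root_oval_of_odd {a b c : ℝ} (hab : a < b) (hbc : b < c) {n : ℕ}
    (hn₂ : 2 ≤ n) (hn₅ : n ≤ 5) (hn : Odd n) :
    ∃! x, (a < x ∧ x < b) ∧ (keyPolynomial (monicCubic a b c) n).IsRoot x := by
  have hp := sub_pos.2 hab
  have hq := sub_pos.2 hbc
  obtain ⟨s, ⟨hs, hs0⟩, huniq⟩ : ∃! s : ℝ, 0 < s ∧
      keyForm ((b - a) ^ 2 * s * (b - a + (c - b) * (1 + s)))
        (-((b - a) ^ 2 * s) - (b - a) * s * (b - a + (c - b) * (1 + s))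
          + (b - a) * (b - a + (c - b) * (1 + s)))
        (2 * (b - a) * s - 2 * (b - a) - 2 * (b - a + (c - b) * (1 + s))) n = 0 := by
    interval_cases n
    · exact absurd hn (by decide)
    · exact existsUnique_keyForm_oval_3 hp hq
    · exact absurd hn (by decide)
    · exact existsUnique_keyForm_oval_5 hp hq
  -- The inverse of `s = (x - a) / (b - x)`.
  have hax : a < (a + b * s) / (1 + s) := by
    rw [lt_div_iff₀ (by linarith)]
    nlinarith
  have hxb : (a + b * s) / (1 + s) < b := by
    rw [div_lt_iff₀ (by linarith)]
    nlinarith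
  refine ⟨(a + b * s) / (1 + s), ⟨⟨hax, hxb⟩, ?_⟩, fun x ⟨⟨hx, hx'⟩, hx0⟩ => ?_⟩
  · refine (isRoot_keyPolynomial_oval_iff hax hxb hn₂ hn₅ rfl rfl ?_).2 hs0
    have h1 : 1 + s ≠ 0 := by linarith
    rw [eq_div_iff (by linarith)]
    field_simp
    ring
  · have hbx : 0 < b - x := sub_pos.2 hx'
    have := huniq ((x - a) / (b - x)) ⟨div_pos (sub_pos.2 hx) hbx,
      (isRoot_keyPolynomial_oval_iff hx hx' hn₂ hn₅ rfl rfl rfl).1 hx0⟩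
    rw [div_eq_iff hbx.ne'] at this
    rw [eq_div_iff (by linarith)]
    linarith

/-! ### Counting the roots. -/

theorem monicCubic_pos_iff {a b c : ℝ} (hab : a < b) (hbc : b < c) (x : ℝ) :
    0 < (monicCubic a b c).eval x ↔ (a < x ∧ x < b) ∨ c < x := by
  rw [eval_monicCubic]
  constructor
  · intro h
    by_contra! hx
    obtain ⟨hx1, hxc⟩ := hx
    rcases le_or_gt x a with hxa | hxa
    · have h1 : 0 ≤ (x - a) * (x - b) := mul_nonneg_of_nonpos_of_nonpos (by linarith) (by linarith)
      exact absurd h (not_lt.2 (mul_nonpos_of_nonneg_of_nonpos h1 (by linarith)))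
    · have hbx := hx1 hxa
      have h1 : 0 ≤ (x - a) * (x - b) := mul_nonneg (by linarith) (by linarith)
      exact absurd h (not_lt.2 (mul_nonpos_of_nonneg_of_nonpos h1 (by linarith)))
  · rintro (⟨h1, h2⟩ | h)
    · exact mul_pos_of_neg_of_neg (mul_neg_of_pos_of_neg (by linarith) (by linarith)) (by linarith)
    · exact mul_pos (mul_pos (by linarith) (by linarith)) (by linarith)

/-- The root count for a monic cubic with three distinct real roots. -/
theorem ncard_positiveRoots_monicCubic {a b c : ℝ} (hab : a < b) (hbc : b < c) {n : ℕ}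
    (hn₂ : 2 ≤ n) (hn₅ : n ≤ 5) :
    {γ : ℝ | (keyPolynomial (monicCubic a b c) n).IsRoot γ ∧
      0 < (monicCubic a b c).eval γ}.ncard = if Even n then 1 else 2 := by
  simp only [monicCubic_pos_iff hab hbc]
  obtain ⟨y, ⟨hy, hy0⟩, hyu⟩ := existsUnique_root_right hab hbc hn₂ hn₅
  split_ifs with hn
  · rw [Set.ncard_eq_one]
    refine ⟨y, Set.ext fun x => ⟨?_, ?_⟩⟩
    · rintro ⟨hx0, ⟨hax, hxb⟩ | hx⟩
      · exact (not_isRoot_oval_of_even hbc hn₂ hn₅ hn hax hxb hx0).elim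
      · exact hyu x ⟨hx, hx0⟩
    · rintro rfl
      exact ⟨hy0, Or.inr hy⟩
  · obtain ⟨z, ⟨hz, hz0⟩, hzu⟩ :=
      existsUnique_root_oval_of_odd hab hbc hn₂ hn₅ (Nat.not_even_iff_odd.1 hn)
    rw [Set.ncard_eq_two]
    refine ⟨z, y, (hz.2.trans (hbc.trans hy)).ne, Set.ext fun x => ⟨?_, ?_⟩⟩
    · rintro ⟨hx0, hx | hx⟩
      · exact Or.inl (hzu x ⟨hx, hx0⟩)
      · exact Or.inr (hyu x ⟨hx, hx0⟩)
    · rintro (rfl | rfl)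
      · exact ⟨hz0, Or.inl hz⟩
      · exact ⟨hy0, Or.inr hy⟩

theorem exists_legendreCubic_eq_monicCubic {lam : ℝ} (h₀ : lam ≠ 0) (h₁ : lam ≠ 1) :
    ∃ a b c : ℝ, a < b ∧ b < c ∧ legendreCubic lam = monicCubic a b c := by
  rcases lt_or_gt_of_ne h₀ with h | h
  · exact ⟨lam, 0, 1, h, one_pos, by simp only [legendreCubic, monicCubic, C_0, C_1]; ring⟩
  · rcases lt_or_gt_of_ne h₁ with h' | h'
    · exact ⟨0, lam, 1, h, h', by simp only [legendreCubic, monicCubic, C_0, C_1]; ring⟩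
    · exact ⟨0, 1, lam, one_pos, h', by simp only [legendreCubic, monicCubic, C_0, C_1]; ring⟩

theorem mainTheorem1 (n : ℕ) (hn₂ : 2 ≤ n) (hn₅ : n ≤ 5) (lam : ℝ)
    (h₀ : lam ≠ 0) (h₁ : lam ≠ 1) :
    (Odd (n - 1) → (positiveRealRoots n lam).ncard = 1) ∧
    (Even (n - 1) → (positiveRealRoots n lam).ncard = 2) := by
  obtain ⟨a, b, c, hab, hbc, hf⟩ := exists_legendreCubic_eq_monicCubic h₀ h₁
  have key := ncard_positiveRoots_monicCubic hab hbc hn₂ hn₅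
  rw [← hf] at key
  -- The subtraction is not truncated, because `n ≥ 2`.
  have hpar : Even n ↔ Odd (n - 1) := by
    obtain ⟨m, rfl⟩ := Nat.exists_eq_add_of_le' (one_le_two.trans hn₂)
    rw [Nat.add_sub_cancel, Nat.even_add_one, Nat.not_even_iff_odd]
  constructor
  · intro h
    rwa [if_pos (hpar.2 h)] at key
  · intro h
    rwa [if_neg fun h' => Nat.not_even_iff_odd.2 (hpar.1 h') h] at key
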